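/- Let $q\in\mathbb{R}^\times$ be such that $q^n\neq 1$ for all $n\geq 1$, and let $u,v\in\mathbb{R}$ with $u+v\neq 0$. The Podleś quantum 2-sphere with these parameters is the $\mathbb{C}$-algebra $S$ generated by $X,Y,Z$ subject to $$XZ=q^2ZX,\quad ZY=q^2YZ,\quad YX=uv+(u-v)Z-Z^2,\quad XY=uv+q^2(u-v)Z-q^4Z^2.$$ For a field $k$, $\lambda\in k^\times$, $\eta\in k$ and $\varphi\in k[z]$, the generalized Weyl algebra $k[z;\lambda,\eta,\varphi(z)]$ is the $k$-algebra generated over $k[z]$ by $x,y$ subject to $xb=\sigma(b)x$, $yb=\sigma^{-1}(b)y$ for $b\in k[z]$, $yx=\varphi$, $xy=\sigma(\varphi)$, where $\sigma$ is the automorphism of the $k$-algebra $k[z]$ with $\sigma(z)=\lambda z+\eta$. A $k$-algebra $A$ is called homologically smooth if $A$, as a module over its enveloping algebra $A\otimes_k A^{\mathrm{op}}$, has a projective resolution of finite length by finitely generated projective modules. Then $S$ is homologically smooth. Moreover $S$ is the generalized Weyl algebra $\mathbb{C}[Z;q^2,0,uv+(u-v)Z-Z^2]$: there is an isomorphism of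 $\mathbb{C}$-algebras $S\to\mathbb{C}[Z;q^2,0,uv+(u-v)Z-Z^2]$ sending $X,Y,Z$ to $x,y,Z$ respectively. (So all quantum 2-spheres, standard or not, are homologically smooth.) -/

import Mathlib

open CategoryTheory Polynomial
open scoped TensorProduct

universe u v

noncomputable section

/-! ### Homological smoothness -/

/-- The `k`-algebra `A`, regarded as a left module over its enveloping algebra `A ⊗[k] Aᵐᵒᵖ` by
`(a ⊗ op b) • m = a * m * b` (Mathlib's `instModuleTensorProductMop`). -/
def diagonalBimodule (k : Type u) [Field k] (A : Type v) [Ring A] [Algebra k A] :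
    ModuleCat.{v} (A ⊗[k] Aᵐᵒᵖ) :=
  letI : Module (A ⊗[k] Aᵐᵒᵖ) A := instModuleTensorProductMop k A
  ModuleCat.of (A ⊗[k] Aᵐᵒᵖ) A

/-- A `k`-algebra `A` is homologically smooth if, as a module over its enveloping algebra, it has
a projective resolution of finite length all of whose terms are finitely generated. -/
def HomologicallySmooth (k : Type u) [Field k] (A : Type v) [Ring A] [Algebra k A] : Prop :=
  ∃ P : ProjectiveResolution (diagonalBimodule k A),
    (∀ i : ℕ, Module.Finite (A ⊗[k] Aᵐᵒᵖ) (P.complex.X i)) ∧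
    ∃ n : ℕ, ∀ i : ℕ, n < i → Limits.IsZero (P.complex.X i)

/-! ### Generalized Weyl algebras -/

namespace GWA

/-- Generators of a generalized Weyl algebra: the elements of `B` and two further ones. -/
inductive Gen (B : Type v) : Type v
  | coeff (b : B) : Gen B
  | x : Gen B
  | y : Gen B

section
variable {k : Type u} [Field k] {B : Type v} [Ring B] [Algebra k B]

/-- The defining relations of `B(σ, a)`. The first three make `B → B(σ, a)` a homomorphism of
`k`-algebras. -/
inductive Rel (σ : B ≃ₐ[k] B) (a : Subalgebra.center k B) :
    FreeAlgebra k (Gen B) → FreeAlgebra k (Gen B) → Prop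
  | add (b c : B) : Rel σ a (FreeAlgebra.ι k (Gen.coeff (b + c)))
      (FreeAlgebra.ι k (Gen.coeff b) + FreeAlgebra.ι k (Gen.coeff c))
  | mul (b c : B) : Rel σ a (FreeAlgebra.ι k (Gen.coeff (b * c)))
      (FreeAlgebra.ι k (Gen.coeff b) * FreeAlgebra.ι k (Gen.coeff c))
  | algebraMap (r : k) : Rel σ a (FreeAlgebra.ι k (Gen.coeff (algebraMap k B r)))
      (algebraMap k (FreeAlgebra k (Gen B)) r)
  | x_coeff (b : B) : Rel σ a (FreeAlgebra.ι k Gen.x * FreeAlgebra.ι k (Gen.coeff b))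
      (FreeAlgebra.ι k (Gen.coeff (σ b)) * FreeAlgebra.ι k Gen.x)
  | y_coeff (b : B) : Rel σ a (FreeAlgebra.ι k Gen.y * FreeAlgebra.ι k (Gen.coeff b))
      (FreeAlgebra.ι k (Gen.coeff (σ.symm b)) * FreeAlgebra.ι k Gen.y)
  | y_x : Rel σ a (FreeAlgebra.ι k Gen.y * FreeAlgebra.ι k Gen.x)
      (FreeAlgebra.ι k (Gen.coeff (a : B)))
  | x_y : Rel σ a (FreeAlgebra.ι k Gen.x * FreeAlgebra.ι k Gen.y)
      (FreeAlgebra.ι k (Gen.coeff (σ (a : B))))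

end
end GWA

/-- The generalized Weyl algebra `B(σ, a)`: generated over `B` by `x`, `y` subject to
`x b = σ(b) x`, `y b = σ⁻¹(b) y`, `y x = a`, `x y = σ(a)`, for `a` central in `B`. -/
def GWA {k : Type u} [Field k] {B : Type v} [Ring B] [Algebra k B]
    (σ : B ≃ₐ[k] B) (a : Subalgebra.center k B) : Type (max u v) :=
  RingQuot (GWA.Rel σ a)

namespace GWA
section
variable {k : Type u} [Field k] {B : Type v} [Ring B] [Algebra k B]
  (σ : B ≃ₐ[k] B) (a : Subalgebra.center k B)

instance : Ring (GWA σ a) := inferInstanceAs (Ring (RingQuot (Rel σ a)))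

instance : Algebra k (GWA σ a) := inferInstanceAs (Algebra k (RingQuot (Rel σ a)))

/-- The class of a generator in `B(σ, a)`. -/
def gen (g : Gen B) : GWA σ a := RingQuot.mkAlgHom k (Rel σ a) (FreeAlgebra.ι k g)

/-- The image of `b : B` in `B(σ, a)`. -/
def coeff (b : B) : GWA σ a := gen σ a (Gen.coeff b)

/-- The generator `x` of `B(σ, a)`. -/
def x : GWA σ a := gen σ a Gen.x

/-- The generator `y` of `B(σ, a)`. -/
def y : GWA σ a := gen σ a Gen.y

end
end GWA

/-- The automorphism `σ` of `k[z]` with `σ(z) = lam * z + η`. -/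
def polySigma {k : Type u} [Field k] (lam : kˣ) (η : k) : k[X] ≃ₐ[k] k[X] :=
  algEquivCMulXAddC (lam : k) η

theorem polySigma_X {k : Type u} [Field k] (lam : kˣ) (η : k) :
    polySigma lam η X = C (lam : k) * X + C η := by
  simp [polySigma]

/-- A polynomial as a central element of `k[z]`. -/
def polyCentral {k : Type u} [Field k] (φ : k[X]) : Subalgebra.center k k[X] :=
  ⟨φ, Subalgebra.mem_center_iff.2 fun p => mul_comm p φ⟩

/-- The generalized Weyl algebra `k[z; lam, η, φ(z)]`. -/
abbrev PolyGWA {k : Type u} [Field k] (lam : kˣ) (η : k) (φ : k[X]) : Type u :=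
  GWA (polySigma lam η) (polyCentral φ)

namespace PolyGWA
section
variable {k : Type u} [Field k] (lam : kˣ) (η : k) (φ : k[X])

/-- The generator `x` of `k[z; lam, η, φ(z)]`. -/
def x : PolyGWA lam η φ := GWA.x _ _

/-- The generator `y` of `k[z; lam, η, φ(z)]`. -/
def y : PolyGWA lam η φ := GWA.y _ _

/-- The generator `z` of `k[z; lam, η, φ(z)]`. -/
def z : PolyGWA lam η φ := GWA.coeff _ _ X

end
end PolyGWA

/-! ### Podleś quantum 2-spheres -/

namespace QuantumSphere

/-- The three generators of a quantum 2-sphere. -/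
inductive Gen : Type
  | X : Gen
  | Y : Gen
  | Z : Gen

/-- A generator as an element of the free algebra `ℂ⟨X, Y, Z⟩`. -/
def free (g : Gen) : FreeAlgebra ℂ Gen := FreeAlgebra.ι ℂ g

/-- The relations `X Z = q² Z X`, `Z Y = q² Y Z`, `Y X = u v + (u - v) Z - Z²` and
`X Y = u v + q² (u - v) Z - q⁴ Z²`. -/
inductive Rel (q u v : ℝ) : FreeAlgebra ℂ Gen → FreeAlgebra ℂ Gen → Prop
  | X_Z : Rel q u v (free Gen.X * free Gen.Z)
      (((q : ℂ) ^ 2) • (free Gen.Z * free Gen.X))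
  | Z_Y : Rel q u v (free Gen.Z * free Gen.Y)
      (((q : ℂ) ^ 2) • (free Gen.Y * free Gen.Z))
  | Y_X : Rel q u v (free Gen.Y * free Gen.X)
      (((u : ℂ) * v) • (1 : FreeAlgebra ℂ Gen) + ((u : ℂ) - v) • free Gen.Z - free Gen.Z ^ 2)
  | X_Y : Rel q u v (free Gen.X * free Gen.Y)
      (((u : ℂ) * v) • (1 : FreeAlgebra ℂ Gen) + ((q : ℂ) ^ 2 * ((u : ℂ) - v)) • free Gen.Z
        - ((q : ℂ) ^ 4) • free Gen.Z ^ 2)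

end QuantumSphere

/-- The Podleś quantum 2-sphere with parameters `q`, `u`, `v`, as a `ℂ`-algebra. -/
def QuantumSphere (q u v : ℝ) : Type := RingQuot (QuantumSphere.Rel q u v)

namespace QuantumSphere

instance (q u v : ℝ) : Ring (QuantumSphere q u v) :=
  inferInstanceAs (Ring (RingQuot (Rel q u v)))

instance (q u v : ℝ) : Algebra ℂ (QuantumSphere q u v) :=
  inferInstanceAs (Algebra ℂ (RingQuot (Rel q u v)))

/-- The class of a generator in the quantum 2-sphere. -/
def gen (q u v : ℝ) (g : Gen) : QuantumSphere q u v := RingQuot.mkAlgHom ℂ (Rel q u v) (free g)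

end QuantumSphere

/-- The polynomial `u v + (u - v) Z - Z²` over `ℂ`, for real `u`, `v`. -/
def spherePoly (u v : ℝ) : ℂ[X] :=
  C ((u : ℂ) * v) + C ((u : ℂ) - v) * X - X ^ 2

/-- A nonzero real number as a nonzero complex number. -/
def unitOfReal (q : ℝˣ) : ℂˣ := Units.map (algebraMap ℝ ℂ : ℝ →* ℂ) q

end

/-!
Write `S` for the quantum sphere, `E` for its enveloping algebra, `φ = u v + (u - v) z - z²` and
`l = q²`. Homological smoothness is proved with a resolution `0 → K → E³ → E → S → 0` of length two,
and the only serious point is that `K` is projective.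

Exactness needs nothing but the presentation of `S` by three generators and four relations. The
kernel of multiplication `E → S` is generated by `x ⊗ 1 - 1 ⊗ x` and its analogues for `y`, `z`, and
the kernel `K` of the resulting map `E³ → E` is generated by the four rows of the noncommutative
Jacobian matrix of the relations, because `E³` modulo these rows carries a derivation of `S` which
inverts the map (`QuantumSphere.ker_differential`).

Projectivity of `K` is where the two roots `u`, `-v` of `φ` have to be distinct. For the commutative
surface `y x = φ(z)`, smoothness follows from `φ'² + 4 φ = (u + v)²`: the vector field
`4 x ∂ₓ + φ' ∂_z`, completed by exterior multiplication by `φ' dz`, contracts the tail of the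
standard resolution of the diagonal. A deformation of this homotopy still works for `S`, and takes the form
of the matrix identity `BimoduleGenerators.homotopy_identity`:
`homotopy₂ * syzygies + jacobian * homotopy₁ + defectCol * defectRow = (u + v)²`.
Since `syzygies * jacobian = 0`, it makes `K` a direct summand of `E⁴` as soon as `defectCol` kills
the kernel of `jacobian` (`BimoduleGenerators.vecMul_defectCol_eq_zero`).
For this last point one has to know that `S` does not collapse, namely that right multiplication by
`z ⊗ 1 - 1 ⊗ w` is injective on `E` for all `w`. It holds because `S` embeds as a right
`ℂ[z]`-module into a power of `ℂ[z]`, through its regular representation on the free module with basis `xⁿ`, `yⁿ`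
(`QuantumSphere.exists_injective_linearMap`). The condition `q² ≠ 1` enters here too.

The isomorphism with the generalized Weyl algebra comes from the universal properties of both sides.
-/

noncomputable section

/-! ### Splicing projective resolutions -/

section Resolutions

open Limits

variable {C : Type u} [Category.{v} C] [Abelian C]

/-- A complex of projectives that is exact in positive degrees, with an epimorphism `ε` onto `M`
that makes it exact in degree zero, is a projective resolution of `M`. -/
def CategoryTheory.ProjectiveResolution.ofAugmented {M : C} (K : ChainComplex C ℕ)
    (ε : K.X 0 ⟶ M) (hε : Epi ε) (w : K.d 1 0 ≫ ε = 0) (hK : ∀ n, Projective (K.X n))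
    (h₀ : (ShortComplex.mk _ _ w).Exact) (h : ∀ n, K.ExactAt (n + 1)) :
    ProjectiveResolution M where
  complex := K
  projective := hK
  π := (ChainComplex.toSingle₀Equiv _ _).symm ⟨ε, w⟩
  quasiIso := ⟨fun n => by
    cases n
    · rw [ChainComplex.quasiIsoAt₀_iff, ShortComplex.quasiIso_iff_of_zeros']
      · refine (ShortComplex.exact_and_epi_g_iff_of_iso (S₂ := .mk _ _ w) ?_).2 ⟨h₀, hε⟩
        refine ShortComplex.isoMk (Iso.refl _) (Iso.refl _) (Iso.refl _) ?_ ?_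
        · exact (Category.id_comp _).trans (Category.comp_id _).symm
        · exact (Category.id_comp _).trans
            ((ChainComplex.toSingle₀Equiv_symm_apply_f_zero ε w).symm.trans
              (Category.comp_id _).symm)
      all_goals first | rfl | exact K.shape _ _ (by simp)
    · rw [quasiIsoAt_iff_exactAt']
      · exact h _
      · apply ChainComplex.exactAt_succ_single_obj⟩

/-- The augmentation `P₀ ⟶ M` of a projective resolution of `M`, as a morphism onto `M` itself. -/
def CategoryTheory.ProjectiveResolution.augmentation {M : C} (P : ProjectiveResolution M) :
    P.complex.X 0 ⟶ M := P.π.f 0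

/-- Given a short exact sequence `0 ⟶ K ⟶ P ⟶ M ⟶ 0` with `P` projective, a projective resolution
of `K` followed by `P` is a projective resolution of `M`. -/
def CategoryTheory.ProjectiveResolution.splice {S : ShortComplex C} (hS : S.ShortExact)
    (hP : Projective S.X₂) (Q : ProjectiveResolution S.X₁) : ProjectiveResolution S.X₃ :=
  have hw : Q.complex.d 1 0 ≫ Q.augmentation = 0 := Q.complex_d_comp_π_f_zero
  have hQ : (ShortComplex.mk _ _ hw).Exact := Q.exact₀
  have hε : Epi Q.augmentation := inferInstanceAs (Epi (Q.π.f 0))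
  have hw' : Q.complex.d 1 0 ≫ Q.augmentation ≫ S.f = 0 := by
    rw [← Category.assoc, hw, Limits.zero_comp]
  .ofAugmented (Q.complex.augment (Q.augmentation ≫ S.f) hw') S.g hS.epi_g (by
      change (Q.augmentation ≫ S.f) ≫ S.g = 0
      rw [Category.assoc, S.zero, Limits.comp_zero])
    (fun n => by
      cases n
      · exact hP
      · exact Q.projective _)
    (by
      -- precomposing the left map with an epimorphism does not change exactness
      let φ : ShortComplex.mk (Q.augmentation ≫ S.f) S.g
          (by rw [Category.assoc, S.zero, Limits.comp_zero]) ⟶ S :=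
        { τ₁ := Q.augmentation, τ₂ := 𝟙 _, τ₃ := 𝟙 _ }
      have : Epi φ.τ₁ := hε
      have : IsIso φ.τ₂ := inferInstanceAs (IsIso (𝟙 _))
      have : Mono φ.τ₃ := inferInstanceAs (Mono (𝟙 _))
      exact (ShortComplex.exact_iff_of_epi_of_isIso_of_mono φ).2 hS.exact)
    (fun n => by
      cases n
      · rw [HomologicalComplex.exactAt_iff' _ 2 1 0 (by simp) (by simp)]
        -- postcomposing the right map with a monomorphism does not change exactness
        let φ : ShortComplex.mk _ _ hw ⟶ ShortComplex.mk _ _ hw' :=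
          { τ₁ := 𝟙 _, τ₂ := 𝟙 _, τ₃ := S.f }
        have : Epi φ.τ₁ := inferInstanceAs (Epi (𝟙 _))
        have : IsIso φ.τ₂ := inferInstanceAs (IsIso (𝟙 _))
        have : Mono φ.τ₃ := hS.mono_f
        exact (ShortComplex.exact_iff_of_epi_of_isIso_of_mono φ).1 hQ
      · rename_i n
        rw [HomologicalComplex.exactAt_iff' _ (n + 3) (n + 2) (n + 1) (by simp) (by simp)]
        exact Q.exact_succ n)

/-- The module `M` has a projective resolution of finite length by finitely generated modules. -/
def HasFiniteProjectiveResolution {R : Type v} [Ring R] (M : ModuleCat.{v} R) : Prop :=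
  ∃ P : ProjectiveResolution M, (∀ i : ℕ, Module.Finite R (P.complex.X i)) ∧
    ∃ n : ℕ, ∀ i : ℕ, n < i → IsZero (P.complex.X i)

variable {R : Type v} [Ring R]

theorem HasFiniteProjectiveResolution.of_projective (M : Type v) [AddCommGroup M] [Module R M]
    [Module.Finite R M] [Module.Projective R M] :
    HasFiniteProjectiveResolution (ModuleCat.of R M) := by
  have := (ModuleCat.of R M).projective_of_categoryTheory_projective
  have hz (i : ℕ) (hi : 0 < i) :
      IsZero ((ProjectiveResolution.self (ModuleCat.of R M)).complex.X i) :=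
    HomologicalComplex.isZero_single_obj_X _ _ _ _ hi.ne'
  refine ⟨.self (ModuleCat.of R M), fun i => ?_, 0, hz⟩
  cases i with
  | zero => exact inferInstanceAs (Module.Finite R M)
  | succ i =>
    have := ModuleCat.subsingleton_of_isZero (hz (i + 1) i.succ_pos)
    infer_instance

theorem HasFiniteProjectiveResolution.of_shortExact {S : ShortComplex (ModuleCat.{v} R)}
    (hS : S.ShortExact) [Module.Finite R S.X₂] [Module.Projective R S.X₂]
    (h : HasFiniteProjectiveResolution S.X₁) : HasFiniteProjectiveResolution S.X₃ := by
  obtain ⟨Q, hQ, n, hn⟩ := h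
  refine ⟨.splice hS S.X₂.projective_of_categoryTheory_projective Q, fun i => ?_, n + 1,
    fun i hi => ?_⟩
  · cases i
    · exact inferInstanceAs (Module.Finite R S.X₂)
    · exact hQ _
  · obtain ⟨i, rfl⟩ : ∃ j, i = j + 1 := ⟨i - 1, by omega⟩
    exact hn i (by omega)

/-- A module `M` has a finite resolution by finitely generated projectives as soon as some
surjection onto `M` from a finitely generated projective module has a kernel that does. -/
theorem HasFiniteProjectiveResolution.of_surjective {P M : Type v} [AddCommGroup P] [Module R P]
    [AddCommGroup M] [Module R M] [Module.Finite R P] [Module.Projective R P] (f : P →ₗ[R] M)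
    (hf : Function.Surjective f)
    (h : HasFiniteProjectiveResolution (ModuleCat.of R (LinearMap.ker f))) :
    HasFiniteProjectiveResolution (ModuleCat.of R M) := by
  let S : ShortComplex (ModuleCat.{v} R) :=
    .mk (ModuleCat.ofHom (LinearMap.ker f).subtype) (ModuleCat.ofHom f) (by ext x; exact x.2)
  have hS : S.ShortExact :=
    { exact := (ShortComplex.ShortExact.moduleCat_exact_iff_function_exact S).2
        (LinearMap.exact_subtype_ker_map f)
      mono_f := (ModuleCat.mono_iff_injective _).2 Subtype.val_injective
      epi_g := (ModuleCat.epi_iff_surjective _).2 hf }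
  have : Module.Finite R S.X₂ := inferInstanceAs (Module.Finite R P)
  have : Module.Projective R S.X₂ := inferInstanceAs (Module.Projective R P)
  exact .of_shortExact hS h

end Resolutions

/-! ### Enveloping algebras -/

namespace Enveloping

open MulOpposite

variable {k : Type u} [Field k] {A : Type v} [Ring A] [Algebra k A]

/-- Left multiplication by `a`, as the element `a ⊗ 1` of the enveloping algebra. -/
def left (a : A) : A ⊗[k] Aᵐᵒᵖ := a ⊗ₜ 1

/-- Right multiplication by `a`, as the element `1 ⊗ op a` of the enveloping algebra. -/
def right (a : A) : A ⊗[k] Aᵐᵒᵖ := 1 ⊗ₜ op a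

theorem tmul_op_eq (a b : A) : a ⊗ₜ[k] op b = left a * right b := by simp [left, right]

theorem left_one : left (k := k) (1 : A) = 1 := rfl

theorem right_one : right (k := k) (1 : A) = 1 := rfl

theorem left_mul (a b : A) : left (k := k) (a * b) = left a * left b := by simp [left]

theorem right_mul (a b : A) : right (k := k) (a * b) = right b * right a := by simp [right]

theorem right_mul_left (a b : A) : right (k := k) b * left a = left a * right b := by
  simp [left, right]

theorem left_add (a b : A) : left (k := k) (a + b) = left a + left b := TensorProduct.add_tmul ..

theorem right_add (a b : A) : right (k := k) (a + b) = right a + right b :=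
  TensorProduct.tmul_add ..

theorem left_sub (a b : A) : left (k := k) (a - b) = left a - left b := TensorProduct.sub_tmul ..

theorem right_sub (a b : A) : right (k := k) (a - b) = right a - right b :=
  TensorProduct.tmul_sub ..

theorem left_smul (r : k) (a : A) : left (k := k) (r • a) = r • left a := rfl

theorem right_smul (r : k) (a : A) : right (k := k) (r • a) = r • right a := by
  simp [right]

theorem left_algebraMap (r : k) :
    left (k := k) (algebraMap k A r) = algebraMap k (A ⊗[k] Aᵐᵒᵖ) r := rfl

theorem right_algebraMap (r : k) :
    right (k := k) (algebraMap k A r) = algebraMap k (A ⊗[k] Aᵐᵒᵖ) r := by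
  simp [Algebra.algebraMap_eq_smul_one, right_smul, right_one]

variable (k A) in
/-- The action of the enveloping algebra on `1`, that is, the multiplication `a ⊗ op b ↦ a * b`. -/
def mul : A ⊗[k] Aᵐᵒᵖ →ₗ[A ⊗[k] Aᵐᵒᵖ] diagonalBimodule k A :=
  LinearMap.toSpanSingleton _ (diagonalBimodule k A) (1 : A)

theorem mul_tmul (a : A) (b : Aᵐᵒᵖ) : mul k A (a ⊗ₜ b) = a * b.unop := by
  let : Module (A ⊗[k] Aᵐᵒᵖ) A := instModuleTensorProductMop k A
  change (a ⊗ₜ[k] b) • (1 : A) = _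
  rw [TensorProduct.Algebra.smul_def]
  simp

theorem mul_surjective : Function.Surjective (mul k A) := fun (a : A) =>
  ⟨left a, (mul_tmul a 1).trans (mul_one a)⟩

theorem mul_left_sub_right (a : A) : mul k A (left a - right a) = 0 := by
  rw [map_sub, left, right, mul_tmul, mul_tmul, unop_op, unop_one, mul_one, one_mul]
  exact sub_self a

/-- The elements `a` for which a given left ideal of the enveloping algebra contains
`a ⊗ 1 - 1 ⊗ op a` form a subalgebra. -/
def differenceSubalgebra (J : Submodule (A ⊗[k] Aᵐᵒᵖ) (A ⊗[k] Aᵐᵒᵖ)) : Subalgebra k A where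
  carrier := {a | left a - right a ∈ J}
  mul_mem' {a b} ha hb := by
    have : (left (a * b) - right (a * b) : A ⊗[k] Aᵐᵒᵖ)
        = left (k := k) a • (left b - right b) + right (k := k) b • (left a - right a) := by
      simp only [left_mul, right_mul, smul_eq_mul, mul_sub, right_mul_left]
      abel
    rw [Set.mem_ofPred_eq, this]
    exact J.add_mem (J.smul_mem _ hb) (J.smul_mem _ ha)
  add_mem' {a b} ha hb := by
    rw [Set.mem_ofPred_eq, left_add, right_add, add_sub_add_comm]
    exact J.add_mem ha hb
  algebraMap_mem' r := by
    rw [Set.mem_ofPred_eq, left_algebraMap, right_algebraMap, sub_self]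
    exact J.zero_mem

/-- The kernel of multiplication is the left ideal generated by the elements `a ⊗ 1 - 1 ⊗ op a`
with `a` in a set of generators. -/
theorem mem_of_mul_eq_zero {s : Set A} (hs : Algebra.adjoin k s = ⊤)
    {J : Submodule (A ⊗[k] Aᵐᵒᵖ) (A ⊗[k] Aᵐᵒᵖ)} (hJ : ∀ a ∈ s, left a - right a ∈ J)
    {e : A ⊗[k] Aᵐᵒᵖ} (he : mul k A e = 0) : e ∈ J := by
  have hJ' (a : A) : left a - right a ∈ J := by
    have : Algebra.adjoin k s ≤ differenceSubalgebra J := Algebra.adjoin_le hJ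
    exact this (hs ▸ Algebra.mem_top)
  let m : A ⊗[k] Aᵐᵒᵖ →+ A := (mul k A).toAddMonoidHom
  have hm (a : A) (b : Aᵐᵒᵖ) : m (a ⊗ₜ b) = a * b.unop := mul_tmul a b
  have key (e : A ⊗[k] Aᵐᵒᵖ) : e - right (m e) ∈ J := by
    induction e with
    | zero => simp [right]
    | tmul a b =>
      have : a ⊗ₜ[k] b - right (a * b.unop) = right (k := k) b.unop • (left a - right a) := by
        rw [smul_eq_mul, mul_sub, right_mul_left, right_mul, ← tmul_op_eq, op_unop]
      rw [hm, this]
      exact J.smul_mem _ (hJ' a)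
    | add x y hx hy =>
      rw [map_add, right_add, add_sub_add_comm]
      exact J.add_mem hx hy
  have h := key e
  rwa [show m e = 0 from he, right, op_zero, TensorProduct.tmul_zero, sub_zero] at h

/-- A derivation `D : A → M` into a bimodule extends to the map `a ⊗ op b ↦ D(a) b` on the
enveloping algebra. -/
theorem exists_extension_of_derivation {M : Type*} [AddCommGroup M] [Module k M]
    [Module (A ⊗[k] Aᵐᵒᵖ) M] [IsScalarTower k (A ⊗[k] Aᵐᵒᵖ) M] (D : A →ₗ[k] M)
    (hD : ∀ a b, D (a * b) = left (k := k) a • D b + right (k := k) b • D a) :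
    ∃ s : A ⊗[k] Aᵐᵒᵖ →ₗ[k] M, ∀ e a, s (e * (left a - right a)) = e • D a := by
  let s : A ⊗[k] Aᵐᵒᵖ →ₗ[k] M := TensorProduct.lift
    (LinearMap.mk₂ k (fun a b => right (k := k) b.unop • D a)
      (fun a a' b => by rw [map_add, smul_add])
      (fun r a b => by rw [map_smul, smul_algebra_smul_comm])
      (fun a b b' => by rw [← add_smul, ← right_add]; rfl)
      (fun r a b => by rw [← smul_assoc, ← right_smul]; rfl))
  have hs (a b : A) : s (left a * right b) = right (k := k) b • D a := by
    rw [← tmul_op_eq]; rfl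
  refine ⟨s, fun e a => ?_⟩
  induction e with
  | zero =>
    rw [zero_mul, map_zero]
    exact (zero_smul (A ⊗[k] Aᵐᵒᵖ) (D a)).symm
  | tmul c d =>
    obtain ⟨d, rfl⟩ := op_surjective d
    have h1 : left (k := k) c * right d * left a = left (c * a) * right d := by
      rw [mul_assoc, right_mul_left, left_mul, mul_assoc]
    have h2 : left (k := k) c * right d * right a = left c * right (a * d) := by
      rw [right_mul, mul_assoc]
    rw [tmul_op_eq, mul_sub, map_sub, h1, h2, hs, hs, hD, right_mul, smul_add, smul_smul,
      smul_smul, right_mul_left, add_sub_cancel_right]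
  | add x y hx hy => rw [add_mul, map_add, hx, hy, add_smul]

/-- If `A` embeds into a power of `k[X]` in such a way that right multiplication by `z` becomes
multiplication by `X`, then right multiplication by `z ⊗ 1 - 1 ⊗ op w` is injective on the
enveloping algebra, for every `w`. -/
theorem eq_zero_of_mul_left_sub_right_eq_zero {ι : Type*} {z : A} (f : A →ₗ[k] ι → k[X])
    (hf : Function.Injective f) (hz : ∀ a n, f (a * z) n = f a n * X) {w : A}
    {e : A ⊗[k] Aᵐᵒᵖ} (he : e * (left z - right w) = 0) : e = 0 := by
  let F (n : ι) (i : ℕ) : A →ₗ[k] k := lcoeff k i ∘ₗ LinearMap.proj n ∘ₗ f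
  -- the contraction of the first tensor factor along the functional `F n i`
  let G (n : ι) (i : ℕ) : A ⊗[k] Aᵐᵒᵖ →ₗ[k] Aᵐᵒᵖ :=
    (TensorProduct.lid k Aᵐᵒᵖ).toLinearMap ∘ₗ (F n i).rTensor Aᵐᵒᵖ
  have hG (n i a b) : G n i (a ⊗ₜ b) = F n i a • b := by simp [G]
  have hGz (n i e) : G n (i + 1) (e * left z) = G n i e := by
    induction e with
    | zero => simp
    | tmul a b =>
      have : F n (i + 1) (a * z) = F n i a := by simp [F, hz]
      rw [left, Algebra.TensorProduct.tmul_mul_tmul, hG, hG, mul_one, this]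
    | add x y hx hy => rw [add_mul, map_add, hx, hy, map_add]
  have hGw (n i e) : G n i (e * right w) = G n i e * op w := by
    induction e with
    | zero => simp
    | tmul a b =>
      rw [right, Algebra.TensorProduct.tmul_mul_tmul, hG, hG, mul_one, smul_mul_assoc]
    | add x y hx hy => rw [add_mul, map_add, hx, hy, map_add, add_mul]
  have hfin (n) (e : A ⊗[k] Aᵐᵒᵖ) : ∃ N, ∀ i ≥ N, G n i e = 0 := by
    induction e with
    | zero => exact ⟨0, by simp⟩
    | tmul a b =>
      refine ⟨(f a n).natDegree + 1, fun i hi => ?_⟩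
      have : F n i a = 0 := coeff_eq_zero_of_natDegree_lt hi
      rw [hG, this, zero_smul]
    | add x y hx hy =>
      obtain ⟨N, hN⟩ := hx
      obtain ⟨N', hN'⟩ := hy
      exact ⟨max N N', fun i hi => by
        rw [map_add, hN i (le_of_max_le_left hi), hN' i (le_of_max_le_right hi), add_zero]⟩
  have hG0 (n i) : G n i e = 0 := by
    have step (i) (h : G n (i + 1) e = 0) : G n i e = 0 := by
      rw [← hGz, sub_eq_zero.1 ((mul_sub _ _ _).symm.trans he), hGw, h, zero_mul]
    obtain ⟨N, hN⟩ := hfin n e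
    by_contra hne
    have hne' (j) : G n (i + j) e ≠ 0 := by
      induction j with
      | zero => exact hne
      | succ j ih => exact fun h => ih (step _ h)
    exact hne' N (hN _ (by omega))
  let ℬ := Module.Free.chooseBasis k Aᵐᵒᵖ
  apply (TensorProduct.equivFinsuppOfBasisRight (M := A) ℬ).injective
  rw [map_zero]
  ext b : 1
  apply hf
  rw [Finsupp.zero_apply, map_zero]
  ext n i : 2
  have hcoord (e : A ⊗[k] Aᵐᵒᵖ) :
      (f (TensorProduct.equivFinsuppOfBasisRight (M := A) ℬ e b) n).coeff i
        = ℬ.repr (G n i e) b := by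
    induction e with
    | zero => simp
    | tmul a c =>
      rw [hG, map_smul]
      simp [F, mul_comm]
    | add x y hx hy => simp only [map_add, Finsupp.add_apply, Pi.add_apply, coeff_add, hx, hy]
  rw [hcoord, hG0]
  simp

end Enveloping

/-! ### The quantum sphere as an algebra -/

namespace QuantumSphere

variable {q u v : ℝ}

variable (q u v) in
/-- The generator `X` of the quantum sphere. -/
abbrev x : QuantumSphere q u v := gen q u v Gen.X

variable (q u v) in
/-- The generator `Y` of the quantum sphere. -/
abbrev y : QuantumSphere q u v := gen q u v Gen.Y

variable (q u v) in
/-- The generator `Z` of the quantum sphere. -/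
abbrev z : QuantumSphere q u v := gen q u v Gen.Z

theorem x_mul_z : x q u v * z q u v = (q : ℂ) ^ 2 • (z q u v * x q u v) := by
  simpa [gen] using! RingQuot.mkAlgHom_rel ℂ (Rel.X_Z (q := q) (u := u) (v := v))

theorem z_mul_y : z q u v * y q u v = (q : ℂ) ^ 2 • (y q u v * z q u v) := by
  simpa [gen] using! RingQuot.mkAlgHom_rel ℂ (Rel.Z_Y (q := q) (u := u) (v := v))

theorem y_mul_x : y q u v * x q u v
    = ((u : ℂ) * v) • (1 : QuantumSphere q u v) + ((u : ℂ) - v) • z q u v - z q u v ^ 2 := by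
  simpa only [map_mul, map_add, map_sub, map_smul, map_pow, map_one] using!
    RingQuot.mkAlgHom_rel ℂ (Rel.Y_X (q := q) (u := u) (v := v))

theorem x_mul_y : x q u v * y q u v
    = ((u : ℂ) * v) • (1 : QuantumSphere q u v) + ((q : ℂ) ^ 2 * ((u : ℂ) - v)) • z q u v
      - (q : ℂ) ^ 4 • z q u v ^ 2 := by
  simpa only [map_mul, map_add, map_sub, map_smul, map_pow, map_one] using!
    RingQuot.mkAlgHom_rel ℂ (Rel.X_Y (q := q) (u := u) (v := v))

/-- The universal property: a triple of elements of an algebra subject to the relations of the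
quantum sphere is the image of the generators under a homomorphism. -/
theorem exists_algHom {B : Type*} [Ring B] [Algebra ℂ B] (f : Gen → B)
    (hXZ : f .X * f .Z = (q : ℂ) ^ 2 • (f .Z * f .X))
    (hZY : f .Z * f .Y = (q : ℂ) ^ 2 • (f .Y * f .Z))
    (hYX : f .Y * f .X = ((u : ℂ) * v) • (1 : B) + ((u : ℂ) - v) • f .Z - f .Z ^ 2)
    (hXY : f .X * f .Y = ((u : ℂ) * v) • (1 : B) + ((q : ℂ) ^ 2 * ((u : ℂ) - v)) • f .Z
      - (q : ℂ) ^ 4 • f .Z ^ 2) :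
    ∃ F : QuantumSphere q u v →ₐ[ℂ] B, ∀ g, F (gen q u v g) = f g := by
  refine ⟨RingQuot.liftAlgHom ℂ ⟨FreeAlgebra.lift ℂ f, ?_⟩, fun g => ?_⟩
  · rintro _ _ (_ | _ | _ | _) <;>
      simpa only [map_mul, map_add, map_sub, map_smul, map_pow, map_one, free,
        FreeAlgebra.lift_ι_apply]
  · exact (RingQuot.liftAlgHom_mkAlgHom_apply ..).trans (FreeAlgebra.lift_ι_apply ..)

theorem adjoin_range_gen : Algebra.adjoin ℂ (Set.range (gen q u v)) = ⊤ := by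
  let π : FreeAlgebra ℂ Gen →ₐ[ℂ] QuantumSphere q u v := RingQuot.mkAlgHom ℂ (Rel q u v)
  have hπ : Function.Surjective π := RingQuot.mkAlgHom_surjective ℂ (Rel q u v)
  have h : Set.range (gen q u v) = π '' Set.range (FreeAlgebra.ι ℂ) := by
    rw [← Set.range_comp]; rfl
  rw [h, ← AlgHom.map_adjoin, FreeAlgebra.adjoin_range_ι, Algebra.map_top]
  exact (AlgHom.range_eq_top π).2 hπ

theorem algHom_ext {B : Type*} [Semiring B] [Algebra ℂ B] {F G : QuantumSphere q u v →ₐ[ℂ] B}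
    (h : ∀ g, F (gen q u v g) = G (gen q u v g)) : F = G :=
  AlgHom.ext_of_adjoin_eq_top adjoin_range_gen (by rintro _ ⟨g, rfl⟩; exact h g)

/-! ### The regular representation of the quantum sphere -/

theorem z_mul_x_pow (hq : q ≠ 0) (n : ℕ) :
    z q u v * x q u v ^ n = (((q : ℂ) ^ 2)⁻¹ ^ n) • (x q u v ^ n * z q u v) := by
  have hq' : (q : ℂ) ≠ 0 := by exact_mod_cast hq
  induction n with
  | zero => simp
  | succ n ih =>
    rw [pow_succ (x q u v), ← mul_assoc, ih, smul_mul_assoc, mul_assoc _ _ (z q u v), x_mul_z,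
      mul_smul_comm, smul_smul, mul_assoc, pow_succ _ n, mul_assoc (_ ^ n) _ ((q : ℂ) ^ 2),
      inv_mul_cancel₀ (by positivity), mul_one]

theorem z_mul_y_pow (n : ℕ) :
    z q u v * y q u v ^ n = (((q : ℂ) ^ 2) ^ n) • (y q u v ^ n * z q u v) := by
  induction n with
  | zero => simp
  | succ n ih =>
    rw [pow_succ (y q u v), ← mul_assoc, ih, smul_mul_assoc, mul_assoc, z_mul_y, mul_smul_comm,
      smul_smul, ← pow_succ, mul_assoc]

variable (q u v) in
/-- The polynomial `φ(q⁻²ⁿ z)`, where `φ = u v + (u - v) z - z²`. -/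
def twist (n : ℤ) : ℂ[X] :=
  C ((u : ℂ) * v) + C (((u : ℂ) - v) * ((q : ℂ) ^ 2) ^ (-n)) * X
    - C (((q : ℂ) ^ 2) ^ (-n)) ^ 2 * X ^ 2

/-- The free right `ℂ[z]`-module on the basis `xⁿ` (`n ≥ 0`) and `y⁻ⁿ` (`n < 0`), which carries the
regular representation of the quantum sphere. -/
abbrev RegularModule : Type := ℤ →₀ ℂ[X]

namespace RegularModule

variable (q u v) in
/-- Left multiplication by `x` in terms of the basis. -/
def opX : Module.End ℂ[X] RegularModule :=
  Finsupp.lsum ℕ fun n => (if 0 ≤ n then 1 else twist q u v n) • Finsupp.lsingle (n + 1)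

variable (q u v) in
/-- Left multiplication by `y` in terms of the basis. -/
def opY : Module.End ℂ[X] RegularModule :=
  Finsupp.lsum ℕ fun n => (if n ≤ 0 then 1 else twist q u v (n - 1)) • Finsupp.lsingle (n - 1)

variable (q) in
/-- Left multiplication by `z` in terms of the basis. -/
def opZ : Module.End ℂ[X] RegularModule :=
  Finsupp.lsum ℕ fun n => (C (((q : ℂ) ^ 2) ^ (-n)) * X) • Finsupp.lsingle n

theorem opX_single (n : ℤ) (p : ℂ[X]) : opX q u v (Finsupp.single n p)
    = Finsupp.single (n + 1) ((if 0 ≤ n then 1 else twist q u v n) * p) := by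
  by_cases hn : 0 ≤ n <;> simp [opX, hn]

theorem opY_single (n : ℤ) (p : ℂ[X]) : opY q u v (Finsupp.single n p)
    = Finsupp.single (n - 1) ((if n ≤ 0 then 1 else twist q u v (n - 1)) * p) := by
  by_cases hn : n ≤ 0 <;> simp [opY, hn]

theorem opZ_single (n : ℤ) (p : ℂ[X]) : opZ q (Finsupp.single n p)
    = Finsupp.single n (C (((q : ℂ) ^ 2) ^ (-n)) * X * p) := by
  simp [opZ]

/-- The regular representation of the quantum sphere. -/
theorem exists_representation (hq : q ≠ 0) :
    ∃ ρ : QuantumSphere q u v →ₐ[ℂ] Module.End ℂ[X] RegularModule,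
      ρ (x q u v) = opX q u v ∧ ρ (y q u v) = opY q u v ∧ ρ (z q u v) = opZ q := by
  have hq' : ((q : ℂ) ^ 2) ≠ 0 := by
    have : (q : ℂ) ≠ 0 := by exact_mod_cast hq
    positivity
  have hs (n : ℤ) : ((q : ℂ) ^ 2) ^ (-n) = (q : ℂ) ^ 2 * ((q : ℂ) ^ 2) ^ (-(n + 1)) := by
    rw [← zpow_one_add₀ hq']; congr 1; omega
  have hp (n : ℤ) : ((q : ℂ) ^ 2) ^ (-(n - 1)) = (q : ℂ) ^ 2 * ((q : ℂ) ^ 2) ^ (-n) := by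
    rw [hs (n - 1), sub_add_cancel]
  let f : Gen → Module.End ℂ[X] RegularModule := Gen.rec (opX q u v) (opY q u v) (opZ q)
  suffices h : ∃ ρ : QuantumSphere q u v →ₐ[ℂ] _, ∀ g, ρ (gen q u v g) = f g from
    h.imp fun ρ hρ => ⟨hρ _, hρ _, hρ _⟩
  refine exists_algHom f ?_ ?_ ?_ ?_ <;> simp only [f]
  · refine Finsupp.lhom_ext fun n p => ?_
    simp only [Module.End.mul_apply, LinearMap.smul_apply, opX_single, opZ_single,
      Finsupp.smul_single, hs n, smul_eq_C_mul, map_mul]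
    congr 1
    ring
  · refine Finsupp.lhom_ext fun n p => ?_
    simp only [Module.End.mul_apply, LinearMap.smul_apply, opY_single, opZ_single,
      Finsupp.smul_single, hp n, smul_eq_C_mul, map_mul]
    congr 1
    ring
  · refine Finsupp.lhom_ext fun n p => ?_
    simp only [Module.End.mul_apply, LinearMap.smul_apply, LinearMap.add_apply,
      LinearMap.sub_apply, Module.End.one_apply, opX_single, opY_single, opZ_single,
      pow_two (opZ q), Finsupp.smul_single, smul_eq_C_mul, add_sub_cancel_right, ← Finsupp.single_add,
      ← Finsupp.single_sub]
    congr 1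
    by_cases hn : 0 ≤ n
    · have hn' : ¬ n + 1 ≤ 0 := by omega
      simp only [hn, hn', if_true, if_false, twist, map_mul, pow_two]
      ring
    · have hn' : n + 1 ≤ 0 := by omega
      simp only [hn, hn', if_true, if_false, twist, map_mul, pow_two]
      ring
  · refine Finsupp.lhom_ext fun n p => ?_
    simp only [Module.End.mul_apply, LinearMap.smul_apply, LinearMap.add_apply,
      LinearMap.sub_apply, Module.End.one_apply, opX_single, opY_single, opZ_single,
      pow_two (opZ q), Finsupp.smul_single, smul_eq_C_mul, sub_add_cancel, ← Finsupp.single_add,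
      ← Finsupp.single_sub]
    congr 1
    by_cases hn : n ≤ 0
    · have hn' : ¬ 0 ≤ n - 1 := by omega
      simp only [hn, hn', if_true, if_false, twist, hp n, map_mul, map_pow]
      ring
    · have hn' : 0 ≤ n - 1 := by omega
      simp only [hn, hn', if_true, if_false, twist, hp n, map_mul, map_pow]
      ring

variable (q u v) in
/-- The basis element `xⁿ` for `n ≥ 0` and `y⁻ⁿ` for `n ≤ 0`. -/
def monomial (n : ℤ) : QuantumSphere q u v := x q u v ^ n.toNat * y q u v ^ (-n).toNat

theorem z_mul_monomial (hq : q ≠ 0) (n : ℤ) : z q u v * monomial q u v n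
    = ((q : ℂ) ^ 2) ^ (-n) • (monomial q u v n * z q u v) := by
  obtain ⟨m, rfl | rfl⟩ := n.eq_nat_or_neg
  · simpa [monomial] using z_mul_x_pow hq m
  · simpa [monomial] using z_mul_y_pow (q := q) m

/-- Reading an element of the regular module in the algebra: a left inverse of the
action on the basis element `x⁰`. -/
def toSphere : RegularModule →ₗ[ℂ] QuantumSphere q u v :=
  Finsupp.lsum ℕ fun n => LinearMap.mulLeft ℂ (monomial q u v n) ∘ₗ (aeval (z q u v)).toLinearMap

theorem toSphere_single (n : ℤ) (p : ℂ[X]) :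
    toSphere (Finsupp.single n p) = monomial q u v n * aeval (z q u v) p := by
  simp [toSphere]

theorem toSphere_opZ (hq : q ≠ 0) (w : RegularModule) :
    toSphere (opZ q w) = z q u v * toSphere w := by
  induction w using Finsupp.induction_linear with
  | zero => simp
  | add w w' h h' => rw [map_add, map_add, h, h', map_add, mul_add]
  | single n p =>
    rw [opZ_single, toSphere_single, toSphere_single, ← mul_assoc, z_mul_monomial hq]
    simp [mul_assoc, Algebra.algebraMap_eq_smul_one]

/-- The element `y x` acts on the monomial of degree `n` by a twist of `φ`. -/
theorem y_mul_x_mul_monomial (hq : q ≠ 0) (n : ℤ) : y q u v * x q u v * monomial q u v n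
    = monomial q u v n * aeval (z q u v) (twist q u v n) := by
  have h := z_mul_monomial (u := u) (v := v) hq n
  rw [twist]
  generalize ((q : ℂ) ^ 2) ^ (-n) = t at h ⊢
  simp only [y_mul_x, sub_mul, add_mul, pow_two, mul_assoc, h, mul_smul_comm, smul_mul_assoc,
    one_mul, map_add, map_sub, map_mul, aeval_C, aeval_X, mul_add, mul_sub,
    Algebra.algebraMap_eq_smul_one, mul_one]
  simp only [← mul_assoc, h, smul_mul_assoc]
  module

theorem x_mul_y_mul_monomial (hq : q ≠ 0) (n : ℤ) : x q u v * y q u v * monomial q u v (n + 1)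
    = monomial q u v (n + 1) * aeval (z q u v) (twist q u v n) := by
  have hq' : ((q : ℂ) ^ 2) ≠ 0 := by
    have : (q : ℂ) ≠ 0 := by exact_mod_cast hq
    positivity
  have h := z_mul_monomial (u := u) (v := v) hq (n + 1)
  have ht : ((q : ℂ) ^ 2) ^ (-n) = (q : ℂ) ^ 2 * ((q : ℂ) ^ 2) ^ (-(n + 1)) := by
    rw [← zpow_one_add₀ hq']; congr 1; omega
  rw [twist, ht]
  generalize ((q : ℂ) ^ 2) ^ (-(n + 1)) = t at h ⊢
  simp only [x_mul_y, sub_mul, add_mul, pow_two, mul_assoc, h, mul_smul_comm, smul_mul_assoc,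
    one_mul, map_add, map_sub, map_mul, aeval_C, aeval_X, mul_add, mul_sub,
    Algebra.algebraMap_eq_smul_one, mul_one]
  simp only [← mul_assoc, h, smul_mul_assoc]
  module

theorem x_mul_monomial {n : ℤ} (hn : 0 ≤ n) :
    x q u v * monomial q u v n = monomial q u v (n + 1) := by
  obtain ⟨m, rfl⟩ := Int.eq_ofNat_of_zero_le hn
  have h1 : (-(m : ℤ)).toNat = 0 := by omega
  have h2 : (-((m : ℤ) + 1)).toNat = 0 := by omega
  have h3 : ((m : ℤ) + 1).toNat = m + 1 := by omega
  simp only [monomial, h1, h2, h3, pow_succ', Int.toNat_natCast, pow_zero, mul_one]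

theorem y_mul_monomial {n : ℤ} (hn : n ≤ 0) :
    y q u v * monomial q u v n = monomial q u v (n - 1) := by
  have h1 : n.toNat = 0 := by omega
  have h2 : (n - 1).toNat = 0 := by omega
  have h3 : (-(n - 1)).toNat = (-n).toNat + 1 := by omega
  simp only [monomial, h1, h2, h3, pow_succ', pow_zero, one_mul]

theorem toSphere_opX (hq : q ≠ 0) (w : RegularModule) :
    toSphere (opX q u v w) = x q u v * toSphere w := by
  induction w using Finsupp.induction_linear with
  | zero => simp
  | add w w' h h' => rw [map_add, map_add, h, h', map_add, mul_add]
  | single n p =>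
    rw [opX_single, toSphere_single, toSphere_single, ← mul_assoc]
    by_cases hn : 0 ≤ n
    · rw [if_pos hn, one_mul, x_mul_monomial hn]
    · have h : monomial q u v n = y q u v * monomial q u v (n + 1) := by
        rw [y_mul_monomial (by omega), add_sub_cancel_right]
      rw [if_neg hn, map_mul, ← mul_assoc, ← x_mul_y_mul_monomial hq, h, ← mul_assoc]

theorem toSphere_opY (hq : q ≠ 0) (w : RegularModule) :
    toSphere (opY q u v w) = y q u v * toSphere w := by
  induction w using Finsupp.induction_linear with
  | zero => simp
  | add w w' h h' => rw [map_add, map_add, h, h', map_add, mul_add]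
  | single n p =>
    rw [opY_single, toSphere_single, toSphere_single, ← mul_assoc]
    by_cases hn : n ≤ 0
    · rw [if_pos hn, one_mul, y_mul_monomial hn]
    · have h : monomial q u v n = x q u v * monomial q u v (n - 1) := by
        rw [x_mul_monomial (by omega), sub_add_cancel]
      rw [if_neg hn, map_mul, ← mul_assoc, ← y_mul_x_mul_monomial hq, h, ← mul_assoc]

end RegularModule

open RegularModule in
/-- As a right `ℂ[z]`-module, the quantum sphere embeds into a power of `ℂ[z]`, through the action
on the basis element `x⁰` of the regular module. -/
theorem exists_injective_linearMap (hq : q ≠ 0) :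
    ∃ f : QuantumSphere q u v →ₗ[ℂ] ℤ → ℂ[X], Function.Injective f ∧
      ∀ a n, f (a * z q u v) n = f a n * X := by
  obtain ⟨ρ, hx, hy, hz⟩ := exists_representation (u := u) (v := v) hq
  let f : QuantumSphere q u v →ₗ[ℂ] RegularModule :=
    { toFun a := ρ a (Finsupp.single 0 1)
      map_add' a b := by rw [map_add, LinearMap.add_apply]
      map_smul' r a := by rw [map_smul, LinearMap.smul_apply, RingHom.id_apply] }
  -- `toSphere` intertwines the regular representation with left multiplication
  have hmul (a : QuantumSphere q u v) : ∀ w, toSphere (ρ a w) = a * toSphere w := by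
    have ha : a ∈ Algebra.adjoin ℂ (Set.range (gen q u v)) := by
      rw [adjoin_range_gen]; trivial
    induction ha using Algebra.adjoin_induction with
    | mem b hb =>
      obtain ⟨_ | _ | _, rfl⟩ := hb
      · intro w; rw [hx, toSphere_opX hq]
      · intro w; rw [hy, toSphere_opY hq]
      · intro w; rw [hz, toSphere_opZ hq]
    | algebraMap r =>
      intro w
      rw [AlgHom.commutes, Module.algebraMap_end_apply, map_smul, Algebra.smul_def]
    | add a b _ _ ha hb =>
      intro w
      rw [map_add, LinearMap.add_apply, map_add, ha, hb, add_mul]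
    | mul a b _ _ ha hb =>
      intro w
      rw [map_mul, Module.End.mul_apply, ha, hb, mul_assoc]
  have hf (a) : toSphere (f a) = a := by
    refine (hmul a _).trans ?_
    rw [toSphere_single]
    simp [RegularModule.monomial]
  refine ⟨Finsupp.lcoeFun ∘ₗ f, fun a b h => ?_, fun a n => ?_⟩
  · rw [← hf a, ← hf b]
    exact congrArg _ (DFunLike.coe_injective h)
  · have : f (a * z q u v) = (X : ℂ[X]) • f a := by
      change ρ (a * z q u v) _ = (X : ℂ[X]) • ρ a _
      rw [map_mul, Module.End.mul_apply, hz, opZ_single, ← map_smul]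
      simp
    simp [this, mul_comm]

end QuantumSphere

/-! ### The matrix identities behind the resolution -/

/-- Two triples `X, Y, Z` and `X', Y', Z'` of elements of a `k`-algebra that commute with each other
and satisfy the relations of left, respectively right, multiplication by the generators of the
algebra with `x z = l z x`, `z y = l y z`, `y x = φ(z)`, `x y = φ(l z)`, for `φ = a + b z - z²`. -/
structure BimoduleGenerators {k : Type*} [Field k] (R : Type*) [Ring R] [Algebra k R]
    (l a b : k) where
  /-- Left multiplication by `x`. -/
  X : R
  /-- Left multiplication by `y`. -/
  Y : R
  /-- Left multiplication by `z`. -/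
  Z : R
  /-- Right multiplication by `x`. -/
  X' : R
  /-- Right multiplication by `y`. -/
  Y' : R
  /-- Right multiplication by `z`. -/
  Z' : R
  X_mul_Z : X * Z = l • (Z * X)
  Z_mul_Y : Z * Y = l • (Y * Z)
  Y_mul_X : Y * X = a • (1 : R) + b • Z - Z * Z
  X_mul_Y : X * Y = a • (1 : R) + (l * b) • Z - (l * l) • (Z * Z)
  Z'_mul_X' : Z' * X' = l • (X' * Z')
  Y'_mul_Z' : Y' * Z' = l • (Z' * Y')
  X'_mul_Y' : X' * Y' = a • (1 : R) + b • Z' - Z' * Z'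
  Y'_mul_X' : Y' * X' = a • (1 : R) + (l * b) • Z' - (l * l) • (Z' * Z')
  X'_mul_X : X' * X = X * X'
  X'_mul_Y : X' * Y = Y * X'
  X'_mul_Z : X' * Z = Z * X'
  Y'_mul_X : Y' * X = X * Y'
  Y'_mul_Y : Y' * Y = Y * Y'
  Y'_mul_Z : Y' * Z = Z * Y'
  Z'_mul_X : Z' * X = X * Z'
  Z'_mul_Y : Z' * Y = Y * Z'
  Z'_mul_Z : Z' * Z = Z * Z'

namespace BimoduleGenerators

open Matrix

variable {k : Type*} [Field k] {R : Type*} [Ring R] [Algebra k R] {l a b : k}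
  (g : BimoduleGenerators R l a b)

/-- The value `φ'(z) = b - 2 z`. -/
def deriv : R := b • 1 - (2 : k) • g.Z

/-- The value `φ'(l z) = b - 2 l z`. -/
def derivTwist : R := b • 1 - (2 * l) • g.Z

/-- The differences `x ⊗ 1 - 1 ⊗ x`, which generate the kernel of multiplication. -/
def diff : Fin 3 → R := ![g.X - g.X', g.Y - g.Y', g.Z - g.Z']

/-- The Jacobian matrix of the defining relations: its rows are the noncommutative differentials of
`x z - l z x`, `z y - l y z`, `y x - φ(z)` and `x y - φ(l z)` in the basis `dx`, `dy`, `dz`. -/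
def jacobian : Matrix (Fin 4) (Fin 3) R :=
  !![g.Z' - l • g.Z, 0, g.X - l • g.X';
     0, g.Z - l • g.Z', g.Y' - l • g.Y;
     g.Y, g.X', -(b • 1 - g.Z - g.Z');
     g.Y', g.X, -((l * b) • 1 - (l * l) • (g.Z + g.Z'))]

/-- The relations among elements `ξ` killed by the Jacobian matrix, written out as the
differentiated relations `d(x z) = l d(z x)`, and so on. -/
theorem jacobian_relations {M : Type*} [AddCommGroup M]
    [Module k M] [Module R M] [IsScalarTower k R M] {ξ : Fin 3 → M}
    (hξ : ∀ i, ∑ j, g.jacobian i j • ξ j = 0) :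
    g.X • ξ 2 + g.Z' • ξ 0 = l • (g.Z • ξ 0 + g.X' • ξ 2) ∧
    g.Z • ξ 1 + g.Y' • ξ 2 = l • (g.Y • ξ 2 + g.Z' • ξ 1) ∧
    g.Y • ξ 0 + g.X' • ξ 1 = b • ξ 2 - (g.Z • ξ 2 + g.Z' • ξ 2) ∧
    g.X • ξ 1 + g.Y' • ξ 0 = (l * b) • ξ 2 - (l * l) • (g.Z • ξ 2 + g.Z' • ξ 2) := by
  refine ⟨?_, ?_, ?_, ?_⟩
  · rw [← sub_eq_zero, ← hξ 0]
    simp [jacobian, Fin.sum_univ_three, sub_smul]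
    abel
  · rw [← sub_eq_zero, ← hξ 1]
    simp [jacobian, Fin.sum_univ_three, sub_smul]
    abel
  · rw [← sub_eq_zero, ← hξ 2]
    simp [jacobian, Fin.sum_univ_three, sub_smul]
    abel
  · rw [← sub_eq_zero, ← hξ 3]
    simp [jacobian, Fin.sum_univ_three, sub_smul, add_smul]
    abel

theorem jacobian_mulVec_diff (hl : l ≠ 0) : g.jacobian *ᵥ g.diff = 0 := by
  have hXZ := g.X_mul_Z
  have hYZ : g.Y * g.Z = l⁻¹ • (g.Z * g.Y) := by rw [g.Z_mul_Y, inv_smul_smul₀ hl]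
  ext i
  fin_cases i <;>
    simp [jacobian, diff, Matrix.mulVec, dotProduct, Fin.sum_univ_succ, mul_sub, add_mul,
      sub_mul, smul_add, smul_smul, hXZ, hYZ, g.Z'_mul_X', g.Y_mul_X, g.X_mul_Y, g.Y'_mul_Z',
      g.X'_mul_Y', g.Y'_mul_X', g.X'_mul_Y, g.X'_mul_Z, g.Y'_mul_X, g.Y'_mul_Z,
      g.Z'_mul_X, g.Z'_mul_Y, g.Z'_mul_Z]
  all_goals match_scalars <;> field_simp <;> ring

/-- The syzygies among the rows of the Jacobian matrix that come from the overlaps `x y x`,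
`y x y`, `z y x` and `z x y` of the relations. -/
def syzygies : Matrix (Fin 4) (Fin 4) R :=
  !![b • 1 - l • g.Z - g.Z', 0, g.X, -g.X';
     0, -(b • 1 - g.Z - l • g.Z'), -g.Y', g.Y;
     g.Y, -g.X', g.Z - g.Z', 0;
     g.Y', -g.X, 0, l • (g.Z - g.Z')]

theorem syzygies_mul_jacobian (hl : l ≠ 0) : g.syzygies * g.jacobian = 0 := by
  have hXZ := g.X_mul_Z
  have hYZ : g.Y * g.Z = l⁻¹ • (g.Z * g.Y) := by rw [g.Z_mul_Y, inv_smul_smul₀ hl]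
  have hXZ' : g.X' * g.Z' = l⁻¹ • (g.Z' * g.X') := by rw [g.Z'_mul_X', inv_smul_smul₀ hl]
  ext i j
  fin_cases i <;> fin_cases j <;>
    simp [syzygies, jacobian, Matrix.mul_apply, Fin.sum_univ_succ, mul_add, mul_sub,
      sub_mul, smul_sub, smul_add, smul_smul, hXZ, hYZ, hXZ', g.Y_mul_X, g.X_mul_Y, g.Y'_mul_Z',
      g.X'_mul_Y', g.Y'_mul_X', g.X'_mul_X, g.X'_mul_Y, g.X'_mul_Z, g.Y'_mul_X, g.Y'_mul_Y,
      g.Y'_mul_Z, g.Z'_mul_X, g.Z'_mul_Y, g.Z'_mul_Z]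
  all_goals try (match_scalars <;> field_simp <;> ring)

/-- The part of the contracting homotopy that goes from the relations to the syzygies, multiplied by
the discriminant `b² + 4 a = φ'² + 4 φ`. In the commutative limit it combines exterior
multiplication by `φ' dz` with contraction along the vector field `4 x ∂ₓ + φ' ∂_z`. -/
def homotopy₂ : Matrix (Fin 4) (Fin 4) R :=
  !![g.derivTwist, 0, (4 : k) • g.X, 0;
     0, -g.deriv, 0, 0;
     0, 0, -g.deriv, 0;
     0, (4 : k) • g.X, 0, -g.derivTwist]

/-- The part of the contracting homotopy that goes from the differentials `dx`, `dy`, `dz` to the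
relations, multiplied by the discriminant. -/
def homotopy₁ : Matrix (Fin 3) (Fin 4) R :=
  !![g.derivTwist, 0, (4 : k) • g.X, 0;
     0, -g.deriv, 0, 0;
     0, 0, -g.deriv, 0]

/-- Together with `defectRow`, the rank one matrix by which `homotopy₁` and `homotopy₂` fail to
contract the complex in degree two. -/
def defectCol : Matrix (Fin 4) (Fin 1) R :=
  !![g.X'; g.Y; 0; b • 1 - l • g.Z - l • g.Z']

/-- In the commutative limit, the contraction of `dx ∧ dy ∧ dz` along the vector field
`4 x ∂ₓ + φ' ∂_z`. See `defectCol`. -/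
def defectRow : Matrix (Fin 1) (Fin 4) R :=
  !![0, (4 : k) • g.X, -(l • g.deriv), g.derivTwist]

set_option linter.unusedSimpArgs false in
set_option maxHeartbeats 2000000 in
/-- Up to a matrix of rank one, the identity is homotopic to zero in degree two. The scalar on the
right is the discriminant of `φ`. -/
theorem homotopy_identity (hl : l ≠ 0) : g.homotopy₂ * g.syzygies + g.jacobian * g.homotopy₁
    + g.defectCol * g.defectRow = (b ^ 2 + 4 * a) • (1 : Matrix (Fin 4) (Fin 4) R) := by
  have hXZ := g.X_mul_Z
  have hYZ : g.Y * g.Z = l⁻¹ • (g.Z * g.Y) := by rw [g.Z_mul_Y, inv_smul_smul₀ hl]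
  have hXZ' : g.X' * g.Z' = l⁻¹ • (g.Z' * g.X') := by rw [g.Z'_mul_X', inv_smul_smul₀ hl]
  ext i j
  fin_cases i <;> fin_cases j <;>
    simp [syzygies, jacobian, homotopy₁, homotopy₂, defectCol, defectRow, deriv, derivTwist,
      Matrix.mul_apply, Fin.sum_univ_succ, mul_add, mul_sub, add_mul, sub_mul,
      smul_sub, smul_add, smul_smul, hXZ, hYZ, hXZ', g.Y_mul_X, g.X_mul_Y, g.Y'_mul_Z',
      g.X'_mul_Y', g.Y'_mul_X', g.X'_mul_X, g.X'_mul_Y, g.X'_mul_Z, g.Y'_mul_X, g.Y'_mul_Y,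
      g.Y'_mul_Z, g.Z'_mul_X, g.Z'_mul_Y, g.Z'_mul_Z]
  all_goals try (match_scalars <;> field_simp <;> ring)

end BimoduleGenerators

/-! ### Projectivity of the second syzygy -/

/-- The range of a linear map `f` from a projective module is projective if there is an
endomorphism `π` of the source that vanishes on the kernel of `f` and satisfies `f ∘ π = f`. -/
theorem LinearMap.projective_range_of_ker_le {R P M : Type*} [Ring R] [AddCommGroup P] [Module R P]
    [Module.Projective R P] [AddCommGroup M] [Module R M] (f : P →ₗ[R] M) (π : P →ₗ[R] P)
    (hπ : LinearMap.ker f ≤ LinearMap.ker π) (hf : f ∘ₗ π = f) :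
    Module.Projective R (LinearMap.range f) := by
  refine .of_split ((LinearMap.ker f).liftQ π hπ ∘ₗ f.quotKerEquivRange.symm.toLinearMap)
    f.rangeRestrict ?_
  ext ⟨_, c, rfl⟩
  have : f.quotKerEquivRange.symm ⟨f c, c, rfl⟩ = (LinearMap.ker f).mkQ c :=
    f.quotKerEquivRange_symm_apply_image c _
  simpa [this] using LinearMap.congr_fun hf c

namespace BimoduleGenerators

open Matrix

variable {k : Type*} [Field k] {R : Type*} [Ring R] [Algebra k R] {l a b : k}
  (g : BimoduleGenerators R l a b)

theorem defectRow_mul_jacobian_zero (hl : l ≠ 0) :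
    (g.defectRow * g.jacobian) 0 0 = (g.Y' - l • g.Y) * g.derivTwist := by
  have hYZ : g.Y * g.Z = l⁻¹ • (g.Z * g.Y) := by rw [g.Z_mul_Y, inv_smul_smul₀ hl]
  simp [jacobian, defectRow, deriv, derivTwist, Matrix.mul_apply, Fin.sum_univ_succ, mul_sub,
    sub_mul, smul_sub, smul_smul, hYZ, g.Y'_mul_Z]
  match_scalars <;> field_simp

/-- This entry lies in the right ideal of `Y' - l Y` up to a product of two factors of degree one
in `Z`. It degenerates at `l = 1`. -/
theorem defectRow_mul_jacobian_two : (g.defectRow * g.jacobian) 0 2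
    = (g.Y' - l • g.Y) * ((4 : k) • g.X)
      + (l * (1 - l)) • ((b • 1 - (2 * (1 + l)) • g.Z) * (g.Z - g.Z')) := by
  simp [jacobian, defectRow, deriv, derivTwist, Matrix.mul_apply, Fin.sum_univ_succ, mul_add,
    mul_sub, sub_mul, smul_sub, smul_add, smul_smul, g.X_mul_Y, g.Y_mul_X, g.Y'_mul_X]
  module

theorem eq_zero_of_mul_eq_zero
    (hreg : ∀ (s t : k) (e : R), e * (g.Z - (s • 1 + t • g.Z')) = 0 → e = 0)
    {r s t : k} (hr : r ≠ 0) {e : R} (he : e * (r • g.Z + s • 1 + t • g.Z') = 0) : e = 0 := by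
  refine hreg (-r⁻¹ * s) (-r⁻¹ * t) e ?_
  have : g.Z - ((-r⁻¹ * s) • 1 + (-r⁻¹ * t) • g.Z') = r⁻¹ • (r • g.Z + s • 1 + t • g.Z') := by
    match_scalars <;> field_simp
  rw [this, mul_smul_comm, he, smul_zero]

/-- The kernel of the Jacobian matrix is also killed by `defectCol`: for `c` in the kernel,
`homotopy_identity` shows that `e = c * defectCol` satisfies `e * defectRow * jacobian = 0`, and two
entries of `defectRow * jacobian` suffice to conclude that `e = 0`. -/
theorem vecMul_defectCol_eq_zero (h2 : (2 : k) ≠ 0) (hl : l ≠ 0) (hl1 : l ≠ 1) (hl2 : 1 + l ≠ 0)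
    (hreg : ∀ (s t : k) (e : R), e * (g.Z - (s • 1 + t • g.Z')) = 0 → e = 0)
    {c : Fin 4 → R} (hc : c ᵥ* g.jacobian = 0) : c ᵥ* g.defectCol = 0 := by
  have hreg' {r s t : k} (hr : r ≠ 0) {e : R} (he : e * (r • g.Z + s • 1 + t • g.Z') = 0) : e = 0 :=
    g.eq_zero_of_mul_eq_zero hreg hr he
  set e := (c ᵥ* g.defectCol) 0 with he
  have h0 : c ᵥ* g.defectCol ᵥ* (g.defectRow * g.jacobian) = 0 := by
    have h := congrArg (fun M => c ᵥ* (M * g.jacobian)) (g.homotopy_identity hl)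
    simp only [Matrix.add_mul, Matrix.mul_assoc, g.syzygies_mul_jacobian hl, Matrix.mul_zero,
      zero_add, vecMul_add, Matrix.smul_mul, Matrix.one_mul, vecMul_smul, hc, smul_zero] at h
    rw [← vecMul_vecMul, hc, zero_vecMul, zero_add, ← vecMul_vecMul] at h
    exact h
  have h0' (j) : e * (g.defectRow * g.jacobian) 0 j = 0 := by
    simpa [vecMul, dotProduct] using! congrFun h0 j
  have hY : e * (g.Y' - l • g.Y) = 0 := by
    have h := h0' 0
    rw [g.defectRow_mul_jacobian_zero hl, ← mul_assoc] at h
    refine hreg' (r := -(2 * l)) (s := b) (t := 0) (by simp [h2, hl]) ?_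
    convert h using 2
    rw [derivTwist]
    module
  have hZ : e * (b • 1 - (2 * (1 + l)) • g.Z) * (g.Z - g.Z') = 0 := by
    have h := h0' 2
    rw [g.defectRow_mul_jacobian_two, mul_add, ← mul_assoc, hY, zero_mul, zero_add,
      mul_smul_comm, smul_eq_zero_iff_right (by simp [hl, sub_eq_zero, hl1.symm]),
      ← mul_assoc] at h
    exact h
  have he0 : e = 0 := by
    refine hreg' (r := -(2 * (1 + l))) (s := b) (t := 0) (by simp [h2, hl2]) ?_
    refine hreg' (r := 1) (s := 0) (t := -1) one_ne_zero ?_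
    convert hZ using 2 <;> [skip; module]
    congr 1
    module
  ext j
  rw [Subsingleton.elim j 0]
  exact he0

/-- The left module generated by the rows of the Jacobian matrix is projective. -/
theorem projective_range_jacobian (h2 : (2 : k) ≠ 0) (hl : l ≠ 0) (hl1 : l ≠ 1) (hl2 : 1 + l ≠ 0)
    (hd : b ^ 2 + 4 * a ≠ 0)
    (hreg : ∀ (s t : k) (e : R), e * (g.Z - (s • 1 + t • g.Z')) = 0 → e = 0) :
    Module.Projective R (LinearMap.range g.jacobian.vecMulLinear) := by
  -- `δ⁻¹ N` is the identity minus a map into the kernel of the Jacobian matrix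
  set N := g.jacobian * g.homotopy₁ + g.defectCol * g.defectRow with hN
  have hid : N = (b ^ 2 + 4 * a) • 1 - g.homotopy₂ * g.syzygies :=
    eq_sub_of_add_eq' ((add_assoc _ _ _).symm.trans (g.homotopy_identity hl))
  refine LinearMap.projective_range_of_ker_le _ ((b ^ 2 + 4 * a)⁻¹ • N).vecMulLinear
    (fun c hc => ?_) (LinearMap.ext fun c => ?_)
  · have hc' : c ᵥ* g.jacobian = 0 := hc
    have hc'' := g.vecMul_defectCol_eq_zero h2 hl hl1 hl2 hreg hc'
    rw [LinearMap.mem_ker, Matrix.vecMulLinear_apply, vecMul_smul, hN, vecMul_add,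
      ← vecMul_vecMul, hc', ← vecMul_vecMul, hc'', zero_vecMul, zero_vecMul, add_zero, smul_zero]
  · rw [LinearMap.comp_apply, Matrix.vecMulLinear_apply, Matrix.vecMulLinear_apply, vecMul_vecMul,
      hid, Matrix.smul_mul, Matrix.sub_mul, Matrix.mul_assoc, g.syzygies_mul_jacobian hl,
      Matrix.mul_zero, sub_zero, Matrix.smul_mul, Matrix.one_mul, inv_smul_smul₀ hd,
      Matrix.vecMulLinear_apply]

end BimoduleGenerators

/-! ### The resolution of the quantum sphere -/

namespace QuantumSphere

open Enveloping Matrix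

variable {q u v : ℝ}

variable (q u v) in
/-- The enveloping algebra of the quantum sphere. -/
abbrev Env : Type := QuantumSphere q u v ⊗[ℂ] (QuantumSphere q u v)ᵐᵒᵖ

variable (q u v) in
/-- Left and right multiplications by the generators, as elements of the enveloping algebra. -/
def bimoduleGenerators :
    BimoduleGenerators (Env q u v) ((q : ℂ) ^ 2) ((u : ℂ) * v) ((u : ℂ) - v) where
  X := left (x q u v)
  Y := left (y q u v)
  Z := left (z q u v)
  X' := right (x q u v)
  Y' := right (y q u v)
  Z' := right (z q u v)
  X_mul_Z := by rw [← left_mul, x_mul_z, left_smul, left_mul]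
  Z_mul_Y := by rw [← left_mul, z_mul_y, left_smul, left_mul]
  Y_mul_X := by
    rw [← left_mul, y_mul_x, left_sub, left_add, left_smul, left_smul, left_one, pow_two, left_mul]
  X_mul_Y := by
    rw [← left_mul, x_mul_y, left_sub, left_add, left_smul, left_smul, left_one, left_smul,
      pow_two (z q u v), left_mul, ← pow_add]
  Z'_mul_X' := by rw [← right_mul, x_mul_z, right_smul, right_mul]
  Y'_mul_Z' := by rw [← right_mul, z_mul_y, right_smul, right_mul]
  X'_mul_Y' := by
    rw [← right_mul, y_mul_x, right_sub, right_add, right_smul, right_smul, right_one, pow_two,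
      right_mul]
  Y'_mul_X' := by
    rw [← right_mul, x_mul_y, right_sub, right_add, right_smul, right_smul, right_one, right_smul,
      pow_two (z q u v), right_mul, ← pow_add]
  X'_mul_X := right_mul_left _ _
  X'_mul_Y := right_mul_left _ _
  X'_mul_Z := right_mul_left _ _
  Y'_mul_X := right_mul_left _ _
  Y'_mul_Y := right_mul_left _ _
  Y'_mul_Z := right_mul_left _ _
  Z'_mul_X := right_mul_left _ _
  Z'_mul_Y := right_mul_left _ _
  Z'_mul_Z := right_mul_left _ _

/-- The universal property of the differentials: values `ξ` on the generators that satisfy the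
differentiated relations extend to a derivation. -/
theorem exists_derivation {M : Type*} [AddCommGroup M] [Module ℂ M]
    [Module (Env q u v) M] [IsScalarTower ℂ (Env q u v) M] (ξ : Fin 3 → M)
    (hξ : ∀ i, ∑ j, (bimoduleGenerators q u v).jacobian i j • ξ j = 0) :
    ∃ D : QuantumSphere q u v →ₗ[ℂ] M,
      (∀ a b, D (a * b) = left (k := ℂ) a • D b + right (k := ℂ) b • D a) ∧
      D (x q u v) = ξ 0 ∧ D (y q u v) = ξ 1 ∧ D (z q u v) = ξ 2 := by
  -- such a derivation is a section of the square-zero extension of the algebra by `M`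
  let S := QuantumSphere q u v
  let E := S ⊗[ℂ] Sᵐᵒᵖ
  let : Module S M := .compHom M (Algebra.TensorProduct.includeLeftRingHom : S →+* E)
  let : Module Sᵐᵒᵖ M :=
    .compHom M (Algebra.TensorProduct.includeRight : Sᵐᵒᵖ →ₐ[ℂ] E).toRingHom
  have hl (s : S) (m : M) : s • m = left (k := ℂ) s • m := rfl
  have hr (s : S) (m : M) : MulOpposite.op s • m = right (k := ℂ) s • m := rfl
  have : SMulCommClass S Sᵐᵒᵖ M := ⟨fun s t m => by
    obtain ⟨t, rfl⟩ := MulOpposite.op_surjective t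
    rw [hl, hl, hr, hr, smul_smul, smul_smul, right_mul_left]⟩
  have : IsScalarTower ℂ S M := ⟨fun r s m => by rw [hl, hl, left_smul, smul_assoc]⟩
  have : IsScalarTower ℂ Sᵐᵒᵖ M := ⟨fun r s m => by
    obtain ⟨s, rfl⟩ := MulOpposite.op_surjective s
    rw [← MulOpposite.op_smul, hr, hr, right_smul, smul_assoc]⟩
  let f : Gen → TrivSqZeroExt S M :=
    Gen.rec (.inl (x q u v) + .inr (ξ 0)) (.inl (y q u v) + .inr (ξ 1))
      (.inl (z q u v) + .inr (ξ 2))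
  suffices h : ∃ F : S →ₐ[ℂ] TrivSqZeroExt S M, ∀ g, F (gen q u v g) = f g by
    obtain ⟨F, hF⟩ := h
    have hfst : (TrivSqZeroExt.fstHom ℂ S M).comp F = AlgHom.id ℂ S :=
      algHom_ext (by rintro (_ | _ | _) <;> simp [hF, f] <;> rfl)
    have hfst (a) : (F a).fst = a := DFunLike.congr_fun hfst a
    refine ⟨TrivSqZeroExt.sndHom S M |>.restrictScalars ℂ |>.comp F.toLinearMap, fun a b => ?_,
      ?_, ?_, ?_⟩
    · simp [hfst, hl, hr]
    · simp [hF, f]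
    · simp [hF, f]
    · simp [hF, f]
  obtain ⟨h0, h1, h2, h3⟩ := (bimoduleGenerators q u v).jacobian_relations hξ
  simp only [bimoduleGenerators, smul_add] at h0 h1 h2 h3
  refine exists_algHom f ?_ ?_ ?_ ?_ <;> refine TrivSqZeroExt.ext ?_ ?_
  · simpa [f] using! x_mul_z
  · simpa [f, hl, hr] using! h0
  · simpa [f] using! z_mul_y
  · simpa [f, hl, hr] using! h1
  · simpa [f] using! y_mul_x
  · simpa [f, hl, hr, sub_smul, pow_two, -Complex.coe_smul] using! h2
  · simpa [f] using! x_mul_y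
  · simpa [f, hl, hr, mul_smul, ← pow_add, pow_two (TrivSqZeroExt.inl _ + _), -Complex.coe_smul]
      using! h3

variable (q u v) in
/-- The differential `E³ → E` onto the kernel of multiplication. -/
def differential : (Fin 3 → Env q u v)
    →ₗ[Env q u v]
      Env q u v :=
  Fintype.linearCombination _ (bimoduleGenerators q u v).diff

theorem differential_apply (c : Fin 3 → Env q u v) :
    differential q u v c = c 0 * (left (x q u v) - right (x q u v))
      + c 1 * (left (y q u v) - right (y q u v)) + c 2 * (left (z q u v) - right (z q u v)) := by
  simp [differential, Fintype.linearCombination_apply, Fin.sum_univ_three,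
    BimoduleGenerators.diff, bimoduleGenerators]

/-- Exactness of the resolution at `E`. -/
theorem range_differential :
    LinearMap.range (differential q u v) = LinearMap.ker (mul ℂ (QuantumSphere q u v)) := by
  apply le_antisymm
  · rintro _ ⟨c, rfl⟩
    rw [LinearMap.mem_ker, differential_apply]
    simp only [← smul_eq_mul, map_add, map_smul, mul_left_sub_right, smul_zero, add_zero]
  · intro e he
    refine mem_of_mul_eq_zero adjoin_range_gen ?_ he
    rintro _ ⟨_ | _ | _, rfl⟩
    · exact ⟨Pi.single 0 1, by rw [differential_apply]; simp⟩
    · exact ⟨Pi.single 1 1, by rw [differential_apply]; simp⟩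
    · exact ⟨Pi.single 2 1, by rw [differential_apply]; simp⟩

/-- Exactness of the resolution at `E³`. The quotient `M` of `E³` by the rows of the Jacobian matrix
is the target of a derivation that sends the generators to the basis elements; its extension to `E`
recovers the class in `M` of an element of `E³` from the differential. -/
theorem ker_differential (hq : q ≠ 0) : LinearMap.ker (differential q u v)
    = LinearMap.range (bimoduleGenerators q u v).jacobian.vecMulLinear := by
  set N := LinearMap.range (bimoduleGenerators q u v).jacobian.vecMulLinear with hN
  apply le_antisymm
  · let ξ (j : Fin 3) : _ ⧸ N := N.mkQ (Pi.single j 1)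
    have hξ (c : Fin 3 → Env q u v) :
        ∑ j, c j • ξ j = N.mkQ c := by
      simp only [ξ, ← map_smul, ← map_sum]
      congr 1
      ext j
      simp [Pi.single_apply]
    obtain ⟨D, hD, hx, hy, hz⟩ := exists_derivation ξ fun i => by
      rw [hξ, Submodule.mkQ_apply, Submodule.Quotient.mk_eq_zero]
      exact ⟨Pi.single i 1, by rw [Matrix.vecMulLinear_apply, Matrix.single_one_vecMul]; rfl⟩
    obtain ⟨s, hs⟩ := exists_extension_of_derivation D hD
    intro c hc
    have h := congrArg s (show differential q u v c = 0 from hc)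
    rw [differential_apply, map_add, map_add, hs, hs, hs, hx, hy, hz, map_zero,
      ← Fin.sum_univ_three (fun j => c j • ξ j), hξ] at h
    exact (Submodule.Quotient.mk_eq_zero N).1 h
  · rintro _ ⟨c, rfl⟩
    rw [LinearMap.mem_ker, differential, Fintype.linearCombination_apply]
    change (c ᵥ* _) ⬝ᵥ _ = 0
    rw [← dotProduct_mulVec, BimoduleGenerators.jacobian_mulVec_diff _ (by simpa using hq),
      dotProduct_zero]

/-- The resolution is `0 → ker(differential) → E³ → E → S → 0`. The condition `u + v ≠ 0` says that
`φ` has nonzero discriminant `(u + v)²`. -/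
theorem homologicallySmooth (hq : q ≠ 0) (hq2 : q ^ 2 ≠ 1) (huv : u + v ≠ 0) :
    HomologicallySmooth ℂ (QuantumSphere q u v) := by
  have hproj : Module.Projective (Env q u v) (LinearMap.ker (differential q u v)) := by
    obtain ⟨f, hf, hfz⟩ := exists_injective_linearMap (u := u) (v := v) hq
    rw [ker_differential hq]
    refine (bimoduleGenerators q u v).projective_range_jacobian two_ne_zero ?_ ?_ ?_ ?_ ?_
    · exact_mod_cast pow_ne_zero 2 hq
    · exact_mod_cast hq2
    · have : 1 + q ^ 2 ≠ 0 := by positivity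
      exact_mod_cast this
    · have : (u - v) ^ 2 + 4 * (u * v) ≠ 0 := by
        convert pow_ne_zero 2 huv using 1
        ring
      exact_mod_cast this
    · intro s t e he
      refine eq_zero_of_mul_left_sub_right_eq_zero f hf hfz (w := s • 1 + t • z q u v) ?_
      rw [right_add, right_smul, right_smul, right_one]
      exact he
  have hfin : Module.Finite (Env q u v) (LinearMap.ker (differential q u v)) := by
    rw [ker_differential hq]
    infer_instance
  change HasFiniteProjectiveResolution
    (ModuleCat.of (Env q u v) (diagonalBimodule ℂ (QuantumSphere q u v)))
  refine HasFiniteProjectiveResolution.of_surjective (mul ℂ (QuantumSphere q u v)) mul_surjective ?_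
  rw [← range_differential]
  refine HasFiniteProjectiveResolution.of_surjective (differential q u v).rangeRestrict
    (LinearMap.surjective_rangeRestrict _) ?_
  rw [LinearMap.ker_rangeRestrict]
  exact .of_projective (LinearMap.ker (differential q u v))

end QuantumSphere

/-! ### The quantum sphere as a generalized Weyl algebra -/

namespace GWA

variable {k : Type u} [Field k] {B : Type v} [Ring B] [Algebra k B]
  {σ : B ≃ₐ[k] B} {a : Subalgebra.center k B}

theorem coeff_add (b c : B) : coeff σ a (b + c) = coeff σ a b + coeff σ a c := by
  simpa only [map_add] using! RingQuot.mkAlgHom_rel k (Rel.add (σ := σ) (a := a) b c)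

theorem coeff_mul (b c : B) : coeff σ a (b * c) = coeff σ a b * coeff σ a c := by
  simpa only [map_mul] using! RingQuot.mkAlgHom_rel k (Rel.mul (σ := σ) (a := a) b c)

theorem coeff_algebraMap (r : k) :
    coeff σ a (algebraMap k B r) = algebraMap k (GWA σ a) r := by
  simpa only [AlgHom.commutes] using! RingQuot.mkAlgHom_rel k (Rel.algebraMap (σ := σ) (a := a) r)

variable (σ a) in
/-- The homomorphism `B → B(σ, a)`. -/
def coeffHom : B →ₐ[k] GWA σ a where
  toFun := coeff σ a
  map_one' := by simpa using coeff_algebraMap (σ := σ) (a := a) 1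
  map_mul' := coeff_mul
  map_zero' := by simpa using coeff_algebraMap (σ := σ) (a := a) 0
  map_add' := coeff_add
  commutes' := coeff_algebraMap

theorem x_mul_coeff (b : B) : x σ a * coeff σ a b = coeff σ a (σ b) * x σ a := by
  simpa only [map_mul] using! RingQuot.mkAlgHom_rel k (Rel.x_coeff (σ := σ) (a := a) b)

theorem y_mul_coeff (b : B) : y σ a * coeff σ a b = coeff σ a (σ.symm b) * y σ a := by
  simpa only [map_mul] using! RingQuot.mkAlgHom_rel k (Rel.y_coeff (σ := σ) (a := a) b)

theorem y_mul_x : y σ a * x σ a = coeff σ a a := by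
  simpa only [map_mul] using! RingQuot.mkAlgHom_rel k (Rel.y_x (σ := σ) (a := a))

theorem x_mul_y : x σ a * y σ a = coeff σ a (σ a) := by
  simpa only [map_mul] using! RingQuot.mkAlgHom_rel k (Rel.x_y (σ := σ) (a := a))

/-- The universal property of a generalized Weyl algebra. -/
theorem exists_algHom {R : Type*} [Ring R] [Algebra k R] (f : B →ₐ[k] R) (X Y : R)
    (hX : ∀ b, X * f b = f (σ b) * X) (hY : ∀ b, Y * f b = f (σ.symm b) * Y)
    (hYX : Y * X = f a) (hXY : X * Y = f (σ a)) :
    ∃ F : GWA σ a →ₐ[k] R, (∀ b, F (coeff σ a b) = f b) ∧ F (x σ a) = X ∧ F (y σ a) = Y := by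
  let f' : Gen B → R := fun g => Gen.rec (fun b => f b) X Y g
  suffices h : ∃ F : GWA σ a →ₐ[k] R, ∀ g, F (gen σ a g) = f' g from
    h.imp fun F hF => ⟨fun b => hF _, hF _, hF _⟩
  refine ⟨RingQuot.liftAlgHom k ⟨FreeAlgebra.lift k f', ?_⟩, fun g => ?_⟩
  · rintro _ _ (_ | _ | _ | _ | _ | _ | _) <;> simp [f', hX, hY, hYX, hXY]
  · exact (RingQuot.liftAlgHom_mkAlgHom_apply ..).trans (FreeAlgebra.lift_ι_apply ..)

theorem algHom_ext {R : Type*} [Semiring R] [Algebra k R] {F G : GWA σ a →ₐ[k] R}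
    (hB : ∀ b, F (coeff σ a b) = G (coeff σ a b)) (hx : F (x σ a) = G (x σ a))
    (hy : F (y σ a) = G (y σ a)) : F = G := by
  refine RingQuot.ringQuot_ext' k F G (FreeAlgebra.hom_ext (funext fun g => ?_))
  cases g
  exacts [hB _, hx, hy]

end GWA

namespace QuantumSphere

variable {u v : ℝ}

theorem polySigma_spherePoly (l : ℂˣ) : polySigma l 0 (spherePoly u v)
    = C ((u : ℂ) * v) + C ((l : ℂ) * ((u : ℂ) - v)) * X - C ((l : ℂ) ^ 2) * X ^ 2 := by
  simp [polySigma, spherePoly]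
  ring

theorem polySigma_symm_X (l : ℂˣ) : (polySigma l 0).symm (X : ℂ[X]) = C (l⁻¹ : ℂ) * X := by
  rw [AlgEquiv.symm_apply_eq]
  simp [polySigma, ← mul_assoc, ← C_mul]

/-- A twisted commutation rule with the generator extends to all polynomials. -/
theorem mul_aeval_of_mul_eq {k R : Type*} [Field k] [Ring R] [Algebra k R] (σ : k[X] →ₐ[k] k[X])
    {w t : R} (h : w * t = aeval t (σ X) * w) (p : k[X]) :
    w * aeval t p = aeval t (σ p) * w := by
  induction p using Polynomial.induction_on with
  | C r =>
    rw [← algebraMap_eq, AlgHom.commutes, AlgHom.commutes, AlgHom.commutes]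
    exact (Algebra.commutes r w).symm
  | add p p' hp hp' => simp only [map_add, mul_add, add_mul, hp, hp']
  | monomial n r hp =>
    rw [pow_succ, ← mul_assoc, map_mul, ← mul_assoc, hp, aeval_X, mul_assoc, h, ← mul_assoc,
      ← map_mul, ← map_mul]

theorem exists_algEquiv_polyGWA (q : ℝˣ) :
    ∃ e : QuantumSphere (q : ℝ) u v ≃ₐ[ℂ] PolyGWA (unitOfReal q ^ 2) 0 (spherePoly u v),
      e (x q u v) = PolyGWA.x (unitOfReal q ^ 2) 0 (spherePoly u v) ∧
      e (y q u v) = PolyGWA.y (unitOfReal q ^ 2) 0 (spherePoly u v) ∧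
      e (z q u v) = PolyGWA.z (unitOfReal q ^ 2) 0 (spherePoly u v) := by
  set l : ℂˣ := unitOfReal q ^ 2 with hl
  have hl' : ((q : ℝ) : ℂ) ^ 2 = l := by simp [hl, unitOfReal]
  set σ : ℂ[X] ≃ₐ[ℂ] ℂ[X] := polySigma l 0 with hσ
  set a := polyCentral (spherePoly u v)
  have ha : (a : ℂ[X]) = spherePoly u v := rfl
  have hσX : σ X = C (l : ℂ) * X := by rw [hσ, polySigma_X]; simp
  have hσX' : σ.symm X = C (l⁻¹ : ℂ) * X := polySigma_symm_X l
  let c := GWA.coeffHom σ a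
  have hc (b) : GWA.coeff σ a b = c b := rfl
  have hcC (r : ℂ) : c (C r) = r • 1 := by
    rw [← algebraMap_eq, AlgHom.commutes, Algebra.algebraMap_eq_smul_one]
  obtain ⟨F, hF⟩ := exists_algHom (q := q) (u := u) (v := v) (B := GWA σ a)
    (fun g => Gen.rec (GWA.x σ a) (GWA.y σ a) (c X) g)
    (by
      simp only [← hc, GWA.x_mul_coeff, hσX]
      simp only [hc, map_mul, hcC, hl', smul_mul_assoc, one_mul])
    (by
      simp only [← hc, GWA.y_mul_coeff, hσX']
      simp only [hc, map_mul, hcC, hl', smul_mul_assoc, one_mul]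
      rw [smul_inv_smul₀ l.ne_zero])
    (by
      simp only [GWA.y_mul_x, ha, hc, spherePoly, map_add, map_sub, map_mul, map_pow, hcC,
        smul_mul_assoc, one_mul, sub_mul, sub_smul, mul_smul])
    (by
      simp only [GWA.x_mul_y, ha, hσ, polySigma_spherePoly]
      have h4 : ((q : ℝ) : ℂ) ^ 4 = (l : ℂ) ^ 2 := by rw [← hl']; ring
      simp only [hc, h4, hl', map_add, map_sub, map_mul, map_pow, hcC, smul_mul_assoc, one_mul,
        sub_mul, sub_smul, smul_sub, mul_smul, _root_.smul_pow, one_pow])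
  have hFx : F (x q u v) = GWA.x σ a := hF _
  have hFy : F (y q u v) = GWA.y σ a := hF _
  have hFz : F (z q u v) = c X := hF _
  have hz (r : ℂ) : aeval (z q u v) (C r * X) = r • z q u v := by
    rw [map_mul, aeval_C, aeval_X, Algebra.smul_def]
  obtain ⟨G, hGc, hGx, hGy⟩ := GWA.exists_algHom (σ := σ) (a := a) (aeval (z q u v))
    (x q u v) (y q u v)
    (mul_aeval_of_mul_eq σ.toAlgHom (by
      change _ = aeval _ (σ X) * _
      rw [x_mul_z, hσX, hz, hl', smul_mul_assoc]))
    (mul_aeval_of_mul_eq σ.symm.toAlgHom (by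
      change _ = aeval _ (σ.symm X) * _
      rw [hσX', hz, smul_mul_assoc, z_mul_y, hl', inv_smul_smul₀ l.ne_zero]))
    (by
      rw [y_mul_x, ha, spherePoly]
      simp only [map_add, map_sub, map_mul, map_pow, aeval_X, aeval_C,
        Algebra.algebraMap_eq_smul_one, smul_mul_assoc, one_mul, sub_mul, sub_smul, mul_smul])
    (by
      have h4 : ((q : ℝ) : ℂ) ^ 4 = (l : ℂ) ^ 2 := by rw [← hl']; ring
      rw [x_mul_y, ha, hσ, polySigma_spherePoly, hl', h4]
      simp only [map_add, map_sub, map_mul, map_pow, aeval_X, aeval_C,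
        Algebra.algebraMap_eq_smul_one, smul_mul_assoc, one_mul, sub_mul, sub_smul, smul_sub,
        mul_smul, _root_.smul_pow, one_pow])
  have hFG : F.comp G = AlgHom.id ℂ _ := by
    refine GWA.algHom_ext (fun b => ?_) ?_ ?_
    · have : F.comp (aeval (z q u v)) = c := by
        ext
        simp [hFz]
      exact (congrArg F (hGc b)).trans (DFunLike.congr_fun this b)
    · exact (congrArg F hGx).trans hFx
    · exact (congrArg F hGy).trans hFy
  have hGF : G.comp F = AlgHom.id ℂ _ := by
    refine algHom_ext ?_
    rintro (_ | _ | _)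
    · exact (congrArg G hFx).trans hGx
    · exact (congrArg G hFy).trans hGy
    · exact (congrArg G hFz).trans ((hGc X).trans (aeval_X _))
  exact ⟨AlgEquiv.ofAlgHom F G hFG hGF, hFx, hFy, hFz⟩

end QuantumSphere

end

theorem mainTheorem3 (q : ℝˣ) (hq : ∀ n : ℕ, 0 < n → q ^ n ≠ 1) (u v : ℝ) (huv : u + v ≠ 0) :
    HomologicallySmooth ℂ (QuantumSphere (q : ℝ) u v) ∧
    ∃ e : QuantumSphere (q : ℝ) u v ≃ₐ[ℂ] PolyGWA (unitOfReal q ^ 2) 0 (spherePoly u v),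
      e (QuantumSphere.gen q u v QuantumSphere.Gen.X) =
        PolyGWA.x (unitOfReal q ^ 2) 0 (spherePoly u v) ∧
      e (QuantumSphere.gen q u v QuantumSphere.Gen.Y) =
        PolyGWA.y (unitOfReal q ^ 2) 0 (spherePoly u v) ∧
      e (QuantumSphere.gen q u v QuantumSphere.Gen.Z) =
        PolyGWA.z (unitOfReal q ^ 2) 0 (spherePoly u v) := by
  refine ⟨QuantumSphere.homologicallySmooth q.ne_zero ?_ huv,
    QuantumSphere.exists_algEquiv_polyGWA q⟩
  rw [← Units.val_pow_eq_pow_val, Ne, Units.val_eq_one]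
  exact hq 2 two_pos
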